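/- **Proposition (pre-Hilbert d-structure).** Let $\mathbf V$ be a compact Hausdorff smooth manifold of dimension $n+m$ with a surjective submersion $\mathbf V\to M$ onto an $n$-dimensional manifold, an N-connection $T\mathbf V=h\mathbf V\oplus v\mathbf V$ (with $v\mathbf V$ the vertical bundle) and a d-metric, i.e. a smooth Riemannian metric for which $h\mathbf V\perp v\mathbf V$; let $d\mu$ be its Riemannian volume measure. Let $\mathbf C$ be a vector gerbe on $\mathbf V$ with finite-dimensional real typical fibre $Q$: a gerbe (a stack of groupoids on the open sets of $\mathbf V$, locally non-empty and locally connected) in which every object $\mathbf e$ over $\mathbf U$ has an underlying smooth vector bundle over $\mathbf U$ with typical fibre $Q$ and a smooth splitting $\mathbf e=h\mathbf e\oplus v\mathbf e$, every morphism acts by a smooth isomorphism of bundles respecting the splittings, and restriction of objects is restriction of bundles. Let $\mathbf C$ carry a Riemannian d-metric: smooth scalar products $\langle\cdot,\cdot\rangle_{\mathbf e}=\langle\cdot,\cdot\rangle_{h\mathbf e}+\langle\cdot,\cdot\rangle_{v\mathbf e}$ on all objects, preserved by morphisms and by restriction. Let $(\mathbf U_\alpha)_{\alpha\in I}$ be an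 open cover of $\mathbf V$, $\mathbf e_\alpha\in\mathbf C(\mathbf U_\alpha)$ objects, $q_{\alpha\beta}:\mathbf e_\beta|_{\mathbf U_\alpha\cap \mathbf U_\beta}\to\mathbf e_\alpha|_{\mathbf U_\alpha\cap \mathbf U_\beta}$ morphisms, and let $Z=\mathbf Z(q_{\alpha\beta})$ be the real vector space of families $z=(z_\alpha)$ of smooth sections $z_\alpha$ of $\mathbf e_\alpha$ with $z_\alpha=q_{\alpha\beta}(z_\beta)$ on $\mathbf U_\alpha\cap \mathbf U_\beta$. Let $hZ$ (resp. $vZ$) be the subspace of those $z$ with all values in the h-parts (resp. v-parts). A *subordinate family* consists of open sets $\mathbf U'_a\subseteq\mathbf U_{\alpha(a)}$ and smooth functions $f_a\ge 0$ on $\mathbf V$ with $\operatorname{supp} f_a\subseteq\mathbf U'_a$ and locally finite supports, $a\in I'$. It is a *partition of unity* if $\sum_a f_a=1$, and a *quadratic partition of unity* if $\sum_a f_a^2=1$. A *pre-Hilbert d-structure* on $Z$ is a triple of forms $B=B_h+B_v$ such that $B$ is a positive definite symmetric bilinear form, $Z=hZ\oplus vZ$ is a $B$-orthogonal direct sum,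 and $B_h(z_1,z_2)=B(hz_1,hz_2)$, $B_v(z_1,z_2)=B(vz_1,vz_2)$ for the components of $z_1,z_2$ in this decomposition. Then there is a pre-Hilbert d-structure $\langle\cdot,\cdot\rangle=\langle\cdot,\cdot\rangle_h+\langle\cdot,\cdot\rangle_v$ on $Z$ such that: 1. For all ${}_1z,{}_2z\in Z$ the functions $\langle {}_1z_\alpha,{}_2z_\alpha\rangle$ on the sets $\mathbf U_\alpha$ glue to a continuous function on $\mathbf V$, whose integral is $\langle {}_1z,{}_2z\rangle$. 2. For every quadratic partition of unity, $$\langle {}_1z,{}_2z\rangle=\sum_{a}\int_{\mathbf U'_a}\langle f_a\,{}_1z_{\alpha(a)},f_a\,{}_2z_{\alpha(a)}\rangle\,d\mu ,$$ where all integrals exist and only finitely many $f_a$ are non-zero; and $\langle {}_1z,{}_2z\rangle_h$, $\langle {}_1z,{}_2z\rangle_v$ are given in the same way by the h- and the v-parts of the integrand. In particular the value does not depend on the chosen quadratic partition. 3. For every partition of unity, again with convergent integrals and finite sums, $$\langle {}_1z,{}_2z\rangle=\sum_{a}\int_{\mathbf U'_a}\langle f_a\,{}_1z_{\alpha(a)},{}_2z_{\alpha(a)}\rangle\,d\mu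 ,$$ and likewise for the h- and the v-parts; in particular this value does not depend on the chosen partition. Moreover the form $$B_f({}_1z,{}_2z)=\sum_{a}\int_{\mathbf U'_a}\langle f_a\,{}_1z_{\alpha(a)},f_a\,{}_2z_{\alpha(a)}\rangle\,d\mu ,$$ together with the corresponding sums for the h- and the v-parts, is also a pre-Hilbert d-structure on $Z$, and there is a $c>0$ (depending on the partition) with $c\,\langle z,z\rangle\le B_f(z,z)\le\langle z,z\rangle$ for all $z\in Z$. -/

import Mathlib

open Set Bundle TopologicalSpace CategoryTheory Opposite MeasureTheory
open scoped Manifold ContDiff Topology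

noncomputable section

namespace NAnholonomic

universe u v w

/-! ### N-anholonomic manifolds -/

section Manifold

variable {n m : ℕ}
  {M : Type*} [TopologicalSpace M] [ChartedSpace (EuclideanSpace ℝ (Fin n)) M]
  {V : Type*} [TopologicalSpace V] [ChartedSpace (EuclideanSpace ℝ (Fin (n + m))) V]

/-- A nonlinear connection for `p : V → M`: a smooth bundle morphism `N : TV → vV` onto the
vertical bundle `vV = ker dp` with `N ∘ i = id` on `vV`.  The horizontal bundle is `hV = ker N`. -/
structure NConnection [IsManifold (𝓡 (n + m)) ∞ V] (p : V → M) where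
  /-- The projection of `T_u V` onto its vertical subspace. -/
  N (u : V) : TangentSpace (𝓡 (n + m)) u →L[ℝ] TangentSpace (𝓡 (n + m)) u
  vertical (u : V) (X : TangentSpace (𝓡 (n + m)) u) : mfderiv (𝓡 (n + m)) (𝓡 n) p u (N u X) = 0
  comp_incl (u : V) (X : TangentSpace (𝓡 (n + m)) u) :
    mfderiv (𝓡 (n + m)) (𝓡 n) p u X = 0 → N u X = X
  contMDiff : ContMDiff (𝓡 (n + m)).tangent (𝓡 (n + m)).tangent ∞
    (fun X : TangentBundle (𝓡 (n + m)) V ↦ (⟨X.proj, N X.proj X.2⟩ : TangentBundle (𝓡 (n + m)) V))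

/-- A (Riemannian) d-metric on an N-anholonomic manifold: a smooth Riemannian metric for which the
horizontal and the vertical subspaces are orthogonal. -/
structure DMetric [IsManifold (𝓡 (n + m)) ∞ V] {p : V → M} (N : NConnection (n := n) (m := m) p) where
  metric : ContMDiffRiemannianMetric (𝓡 (n + m)) ∞ (EuclideanSpace ℝ (Fin (n + m)))
    (fun u : V ↦ TangentSpace (𝓡 (n + m)) u)
  orthogonal (u : V) (X Y : TangentSpace (𝓡 (n + m)) u) :
    N.N u X = 0 → mfderiv (𝓡 (n + m)) (𝓡 n) p u Y = 0 → metric.inner u X Y = 0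

end Manifold

section RiemannianVolume

variable {d : ℕ} {V : Type*} [TopologicalSpace V] [ChartedSpace (EuclideanSpace ℝ (Fin d)) V]
  [IsManifold (𝓡 d) ∞ V]

/-- The volume density `√ det (g(∂ᵢ, ∂ⱼ))` of a Riemannian metric in the chart at `c`, as a
function of the coordinates `y` in the target of the chart. -/
def volumeDensity (g : ContMDiffRiemannianMetric (𝓡 d) ∞ (EuclideanSpace ℝ (Fin d))
    (fun u : V ↦ TangentSpace (𝓡 d) u)) (c : V) (y : EuclideanSpace ℝ (Fin d)) : ℝ :=
  let φ := chartAt (EuclideanSpace ℝ (Fin d)) c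
  let frame : Fin d → TangentSpace (𝓡 d) (φ.symm y) := fun i ↦
    mfderiv (𝓡 d) (𝓡 d) φ.symm y (EuclideanSpace.single i (1 : ℝ) : EuclideanSpace ℝ (Fin d))
  Real.sqrt (Matrix.of fun i j ↦ g.inner (φ.symm y) (frame i) (frame j)).det

/-- A smooth partition of unity on `V` subordinate to the charts. -/
def chartPartition (d : ℕ) (V : Type*) [TopologicalSpace V]
    [ChartedSpace (EuclideanSpace ℝ (Fin d)) V] [IsManifold (𝓡 d) ∞ V]
    [T2Space V] [SigmaCompactSpace V] : SmoothPartitionOfUnity V (𝓡 d) V univ :=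
  (SmoothPartitionOfUnity.exists_isSubordinate_chartAt_source (𝓡 d) V).choose

/-- The Riemannian volume measure `∑_c (φ_c)⁻¹_* ((ρ_c ∘ φ_c⁻¹) √ det g dy)`, glued from the chart
expressions with a smooth partition of unity `ρ` subordinate to the charts `φ_c`. -/
def riemannianVolume [T2Space V] [SigmaCompactSpace V] [MeasurableSpace V]
    (g : ContMDiffRiemannianMetric (𝓡 d) ∞ (EuclideanSpace ℝ (Fin d))
      (fun u : V ↦ TangentSpace (𝓡 d) u)) : Measure V :=
  Measure.sum fun c : V ↦
    let φ := chartAt (EuclideanSpace ℝ (Fin d)) c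
    (((volume : Measure (EuclideanSpace ℝ (Fin d))).restrict φ.target).withDensity
      (fun y ↦ ENNReal.ofReal (chartPartition d V c (φ.symm y) * volumeDensity g c y))).map φ.symm

end RiemannianVolume

/-! ### Vector bundles with a d-splitting over open sets, and vector gerbes -/

section Gerbe

variable {d : ℕ} {V : Type u} [TopologicalSpace V] [ChartedSpace (EuclideanSpace ℝ (Fin d)) V]
  {Q : Type v} [NormedAddCommGroup Q] [NormedSpace ℝ Q]

/-- A d-vector bundle over the open set `U`: a smooth vector bundle with typical fibre `Q`,
split into an h-part `ker P` and a v-part `range P` by a smooth idempotent bundle morphism `P`. -/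
structure DVectorBundle (Q : Type v) [NormedAddCommGroup Q] [NormedSpace ℝ Q] (U : Opens V) where
  Fib : U → Type w
  [addCommGroup : ∀ x, AddCommGroup (Fib x)]
  [module : ∀ x, Module ℝ (Fib x)]
  [topology : ∀ x, TopologicalSpace (Fib x)]
  [topologicalAddGroup : ∀ x, IsTopologicalAddGroup (Fib x)]
  [continuousSMul : ∀ x, ContinuousSMul ℝ (Fib x)]
  [totalTopology : TopologicalSpace (TotalSpace Q Fib)]
  [fiberBundle : FiberBundle Q Fib]
  [vectorBundle : VectorBundle ℝ Q Fib]
  [smooth : ContMDiffVectorBundle ∞ Q Fib (𝓡 d)]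
  /-- The projection of the fibres onto their v-part. -/
  vproj (x : U) : Fib x →L[ℝ] Fib x
  vproj_idem (x : U) (a : Fib x) : vproj x (vproj x a) = vproj x a
  vproj_contMDiff : ContMDiff ((𝓡 d).prod 𝓘(ℝ, Q)) ((𝓡 d).prod 𝓘(ℝ, Q)) ∞
    (fun p : TotalSpace Q Fib ↦ (⟨p.proj, vproj p.proj p.2⟩ : TotalSpace Q Fib))

namespace DVectorBundle

attribute [instance] addCommGroup module topology topologicalAddGroup continuousSMul totalTopology
  fiberBundle vectorBundle smooth

/-- Smooth sections of a d-vector bundle. -/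
abbrev Section {U : Opens V} (A : DVectorBundle.{u, v, w} (d := d) Q U) :=
  ContMDiffSection (𝓡 d) Q ∞ A.Fib

/-- A smooth fibrewise isomorphism of d-vector bundles `A → B` covering the inclusion `U' ⊆ U` and
respecting the splittings; for `U' = U` this is an isomorphism of d-vector bundles over `U`, and in
general it identifies `A` with the restriction of `B` to `U'`. -/
structure IsoOver {U' U : Opens V} (h : U' ≤ U) (A : DVectorBundle.{u, v, w} (d := d) Q U')
    (B : DVectorBundle.{u, v, w} (d := d) Q U) where
  toEquiv (x : U') : A.Fib x ≃L[ℝ] B.Fib ⟨x, h x.2⟩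
  comm_vproj (x : U') (a : A.Fib x) : toEquiv x (A.vproj x a) = B.vproj _ (toEquiv x a)
  contMDiff : ContMDiff ((𝓡 d).prod 𝓘(ℝ, Q)) ((𝓡 d).prod 𝓘(ℝ, Q)) ∞
    (fun p : TotalSpace Q A.Fib ↦
      (⟨⟨p.proj, h p.proj.2⟩, toEquiv p.proj p.2⟩ : TotalSpace Q B.Fib))

end DVectorBundle

/-- Gerbes on a space `V`: stacks of groupoids over the open sets that are locally non-empty and
locally connected. -/
class IsGerbe (C : Pseudofunctor (LocallyDiscrete (Opens V)ᵒᵖ) Cat.{v, w}) : Prop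
    extends C.IsStack (Opens.grothendieckTopology V) where
  groupoid {U : Opens V} {a b : C.obj (.mk (op U))} (φ : a ⟶ b) : IsIso φ
  locally_nonempty (x : V) : ∃ U : Opens V, x ∈ U ∧ Nonempty (C.obj (.mk (op U)))
  locally_connected {U : Opens V} (a b : C.obj (.mk (op U))) (x : V) (hx : x ∈ U) :
    ∃ (U' : Opens V) (i : U' ⟶ U), x ∈ U' ∧
      Nonempty ((C.map i.op.toLoc).toFunctor.obj a ⟶ (C.map i.op.toLoc).toFunctor.obj b)

universe v₁ u₁

/-- A vector gerbe on `V` with typical fibre `Q`: a gerbe `C` whose objects over `U` are d-vector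
bundles over `U` with typical fibre `Q`, whose morphisms are isomorphisms of d-vector bundles, and
whose restriction functors restrict bundles; that is, a gerbe with a morphism of stacks to the
stack of d-vector bundles (objects may carry additional structure, such as a lift to a principal
bundle of the structure group). -/
structure VectorGerbe (V : Type u) [TopologicalSpace V] (d : ℕ)
    [ChartedSpace (EuclideanSpace ℝ (Fin d)) V]
    (Q : Type v) [NormedAddCommGroup Q] [NormedSpace ℝ Q] where
  /-- The underlying sheaf of categories. -/
  C : Pseudofunctor (LocallyDiscrete (Opens V)ᵒᵖ) Cat.{v₁, u₁}
  isGerbe : IsGerbe C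
  /-- The d-vector bundle of an object. -/
  bundle {U : Opens V} (e : C.obj (.mk (op U))) : DVectorBundle.{u, v, w} (d := d) Q U
  /-- The bundle isomorphism of a morphism. -/
  map {U : Opens V} {e e' : C.obj (.mk (op U))} (φ : e ⟶ e') :
    DVectorBundle.IsoOver le_rfl (bundle e) (bundle e')
  map_id {U : Opens V} (e : C.obj (.mk (op U))) (x : U) (a : (bundle e).Fib x) :
    (map (𝟙 e)).toEquiv x a = a
  map_comp {U : Opens V} {e e' e'' : C.obj (.mk (op U))} (φ : e ⟶ e') (ψ : e' ⟶ e'') (x : U)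
    (a : (bundle e).Fib x) :
    (map (φ ≫ ψ)).toEquiv x a = (map ψ).toEquiv x ((map φ).toEquiv x a)
  /-- The bundle of the restriction of `e` to `U'` is the restriction of the bundle of `e`. -/
  res {U U' : Opens V} (i : U' ⟶ U) (e : C.obj (.mk (op U))) :
    DVectorBundle.IsoOver i.le (bundle ((C.map i.op.toLoc).toFunctor.obj e)) (bundle e)
  res_naturality {U U' : Opens V} (i : U' ⟶ U) {e e' : C.obj (.mk (op U))} (φ : e ⟶ e') (x : U')
    (a : (bundle ((C.map i.op.toLoc).toFunctor.obj e)).Fib x) :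
    (res i e').toEquiv x ((map ((C.map i.op.toLoc).toFunctor.map φ)).toEquiv x a) =
      (map φ).toEquiv ⟨x, i.le x.2⟩ ((res i e).toEquiv x a)
  res_id {U : Opens V} (e : C.obj (.mk (op U))) (x : U)
    (a : (bundle ((C.map (𝟙 U : U ⟶ U).op.toLoc).toFunctor.obj e)).Fib x) :
    (res (𝟙 U) e).toEquiv x a =
      (map ((C.mapId (.mk (op U))).hom.toNatTrans.app e)).toEquiv x a
  res_comp {U U' U'' : Opens V} (i : U' ⟶ U) (j : U'' ⟶ U') (e : C.obj (.mk (op U))) (x : U'')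
    (a : (bundle ((C.map (j ≫ i).op.toLoc).toFunctor.obj e)).Fib x) :
    (res (j ≫ i) e).toEquiv x a =
      (res i e).toEquiv ⟨x, j.le x.2⟩ ((res j _).toEquiv x
        ((map ((C.mapComp i.op.toLoc j.op.toLoc).hom.toNatTrans.app e)).toEquiv x a))

namespace VectorGerbe

/-- The objects of the gerbe over `U`. -/
abbrev Obj (𝒞 : VectorGerbe.{u, v, w, v₁, u₁} V d Q) (U : Opens V) := 𝒞.C.obj (.mk (op U))

/-- The restriction of an object to a smaller open set. -/
abbrev restrict (𝒞 : VectorGerbe.{u, v, w, v₁, u₁} V d Q) {U' U : Opens V} (h : U' ≤ U)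
    (e : 𝒞.Obj U) : 𝒞.Obj U' :=
  (𝒞.C.map (homOfLE h).op.toLoc).toFunctor.obj e

/-- The fibre of an object at a point. -/
abbrev Fib (𝒞 : VectorGerbe.{u, v, w, v₁, u₁} V d Q) {U : Opens V} (e : 𝒞.Obj U) (x : U) :=
  (𝒞.bundle e).Fib x

end VectorGerbe

/-- A Riemannian d-metric on a vector gerbe: a smooth scalar product on the bundle of every object,
for which the h- and the v-part are orthogonal (so that it is the sum of a scalar product on the
h-part and one on the v-part), preserved by the morphisms and the restrictions. -/
structure RiemannianDMetric (𝒞 : VectorGerbe.{u, v, w, v₁, u₁} V d Q) where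
  metric {U : Opens V} (e : 𝒞.Obj U) :
    ContMDiffRiemannianMetric (𝓡 d) ∞ Q (𝒞.bundle e).Fib
  orthogonal {U : Opens V} (e : 𝒞.Obj U) (x : U) (a b : 𝒞.Fib e x) :
    (𝒞.bundle e).vproj x a = 0 → (𝒞.bundle e).vproj x b = b → (metric e).inner x a b = 0
  map_inner {U : Opens V} {e e' : 𝒞.Obj U} (φ : e ⟶ e') (x : U) (a b : 𝒞.Fib e x) :
    (metric e').inner x ((𝒞.map φ).toEquiv x a) ((𝒞.map φ).toEquiv x b) = (metric e).inner x a b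
  res_inner {U U' : Opens V} (i : U' ⟶ U) (e : 𝒞.Obj U) (x : U')
    (a b : 𝒞.Fib (𝒞.restrict i.le e) x) :
    (metric e).inner ⟨x, i.le x.2⟩ ((𝒞.res i e).toEquiv x a) ((𝒞.res i e).toEquiv x b) =
      (metric (𝒞.restrict i.le e)).inner x a b

/-! ### Global sections -/

/-- A Čech 1-chain of a vector gerbe over the open cover `(U_α)`: objects `e_α` over `U_α` and
morphisms `q_αβ` from the restriction of `e_β` to the restriction of `e_α` over `U_α ∩ U_β`. -/
structure CechChain (𝒞 : VectorGerbe.{u, v, w, v₁, u₁} V d Q) (I : Type*) where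
  U : I → Opens V
  covers (x : V) : ∃ α, x ∈ U α
  e (α : I) : 𝒞.Obj (U α)
  q (α β : I) : 𝒞.restrict (inf_le_right : U α ⊓ U β ≤ U β) (e β) ⟶
    𝒞.restrict (inf_le_left : U α ⊓ U β ≤ U α) (e α)

namespace CechChain

variable {𝒞 : VectorGerbe.{u, v, w, v₁, u₁} V d Q} {I : Type*} (q : CechChain 𝒞 I)

/-- The linear isomorphism `(e_β)_x → (e_α)_x` induced by `q_αβ` at a point of `U_α ∩ U_β`. -/
def fibreMap (α β : I) (x : V) (hα : x ∈ q.U α) (hβ : x ∈ q.U β) :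
    𝒞.Fib (q.e β) ⟨x, hβ⟩ ≃L[ℝ] 𝒞.Fib (q.e α) ⟨x, hα⟩ :=
  let y : ↥(q.U α ⊓ q.U β) := ⟨x, hα, hβ⟩
  ((𝒞.res (homOfLE inf_le_right) (q.e β)).toEquiv y).symm.trans
    (((𝒞.map (q.q α β)).toEquiv y).trans ((𝒞.res (homOfLE inf_le_left) (q.e α)).toEquiv y))

/-- The space `Z(q_αβ)` of global sections: families of smooth sections `z_α` of `e_α` with
`z_α = q_αβ (z_β)` on `U_α ∩ U_β`. -/
def globalSections : Submodule ℝ (∀ α, (𝒞.bundle (q.e α)).Section) where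
  carrier := {z | ∀ (α β : I) (x : V) (hα : x ∈ q.U α) (hβ : x ∈ q.U β),
    z α ⟨x, hα⟩ = q.fibreMap α β x hα hβ (z β ⟨x, hβ⟩)}
  add_mem' {z z'} hz hz' α β x hα hβ := by
    simp [hz α β x hα hβ, hz' α β x hα hβ]
  zero_mem' α β x hα hβ := by simp
  smul_mem' c z hz α β x hα hβ := by
    simp [hz α β x hα hβ]

/-- The global sections all of whose values lie in the h-part. -/
def hSections : Submodule ℝ q.globalSections where
  carrier := {z | ∀ (α : I) (x : q.U α), (𝒞.bundle (q.e α)).vproj x (z.1 α x) = 0}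
  add_mem' {z z'} hz hz' α x := by simp [hz α x, hz' α x]
  zero_mem' α x := by simp
  smul_mem' c z hz α x := by simp [hz α x]

/-- The global sections all of whose values lie in the v-part. -/
def vSections : Submodule ℝ q.globalSections where
  carrier := {z | ∀ (α : I) (x : q.U α), (𝒞.bundle (q.e α)).vproj x (z.1 α x) = z.1 α x}
  add_mem' {z z'} hz hz' α x := by simp [hz α x, hz' α x]
  zero_mem' α x := by simp
  smul_mem' c z hz α x := by simp [hz α x]

/-- A form on the fibres of all the objects `e_α` of the chain. -/
abbrev FibreForm := ∀ (α : I) (x : q.U α), 𝒞.Fib (q.e α) x → 𝒞.Fib (q.e α) x → ℝ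

/-- The scalar product `⟨a, b⟩` of the d-metric on the fibres. -/
def innerForm (G : RiemannianDMetric 𝒞) : q.FibreForm := fun α x a b ↦
  (G.metric (q.e α)).inner x a b

/-- The scalar product `⟨ha, hb⟩` of the h-parts. -/
def hForm (G : RiemannianDMetric 𝒞) : q.FibreForm := fun α x a b ↦
  (G.metric (q.e α)).inner x (a - (𝒞.bundle (q.e α)).vproj x a)
    (b - (𝒞.bundle (q.e α)).vproj x b)

/-- The scalar product `⟨va, vb⟩` of the v-parts. -/
def vForm (G : RiemannianDMetric 𝒞) : q.FibreForm := fun α x a b ↦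
  (G.metric (q.e α)).inner x ((𝒞.bundle (q.e α)).vproj x a) ((𝒞.bundle (q.e α)).vproj x b)

/-! ### Partitions and the scalar product -/

/-- A locally finite family of non-negative smooth functions `f_a` with supports in open sets
`U'_a`, subordinate to the cover of the chain: `U'_a ⊆ U_{α(a)}`. -/
structure SubordinateFamily (I' : Type*) where
  U' : I' → Opens V
  idx : I' → I
  le (a : I') : U' a ≤ q.U (idx a)
  f : I' → V → ℝ
  contMDiff (a : I') : ContMDiff (𝓡 d) 𝓘(ℝ, ℝ) ∞ (f a)
  nonneg (a : I') (x : V) : 0 ≤ f a x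
  tsupport_subset (a : I') : tsupport (f a) ⊆ U' a
  locallyFinite : LocallyFinite fun a ↦ Function.support (f a)

namespace SubordinateFamily

variable {q} {I' : Type*} (P : q.SubordinateFamily I')

/-- A partition of unity: `∑ f_a = 1`. -/
def IsPartition : Prop := ∀ x, ∑ᶠ a, P.f a x = 1

/-- A quadratic partition of unity: `∑ f_a ^ 2 = 1`. -/
def IsQuadraticPartition : Prop := ∀ x, ∑ᶠ a, P.f a x ^ 2 = 1

open Classical in
/-- The function `x ↦ B (φ(x) ₁z_{α(a)}(x), ψ(x) ₂z_{α(a)}(x))` on `U_{α(a)}`. -/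
def integrand (B : q.FibreForm) (φ ψ : V → ℝ) (z₁ z₂ : q.globalSections) (a : I') (x : V) : ℝ :=
  if h : x ∈ q.U (P.idx a) then
    B (P.idx a) ⟨x, h⟩ (φ x • z₁.1 (P.idx a) ⟨x, h⟩) (ψ x • z₂.1 (P.idx a) ⟨x, h⟩)
  else 0

/-- `∑_a ∫_{U'_a} B (f_a ₁z_{α(a)}, f_a ₂z_{α(a)}) dμ`. -/
def pairing [MeasurableSpace V] (μ : Measure V) (B : q.FibreForm) (z₁ z₂ : q.globalSections) : ℝ :=
  ∑ᶠ a, ∫ x in (P.U' a : Set V), P.integrand B (P.f a) (P.f a) z₁ z₂ a x ∂μ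

/-- `∑_a ∫_{U'_a} B (f_a ₁z_{α(a)}, ₂z_{α(a)}) dμ`, where the weight `f_a` occurs once. -/
def linearPairing [MeasurableSpace V] (μ : Measure V) (B : q.FibreForm)
    (z₁ z₂ : q.globalSections) : ℝ :=
  ∑ᶠ a, ∫ x in (P.U' a : Set V), P.integrand B (P.f a) (fun _ ↦ 1) z₁ z₂ a x ∂μ

/-- All the integrals in `pairing` and `linearPairing` exist and only finitely many of the
functions `f_a` are non-zero, so that the sums are finite. -/
def Converges [MeasurableSpace V] (μ : Measure V) (B : q.FibreForm) : Prop :=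
  {a | P.f a ≠ 0}.Finite ∧ ∀ (z₁ z₂ : q.globalSections) (a : I'),
    IntegrableOn (P.integrand B (P.f a) (P.f a) z₁ z₂ a) (P.U' a) μ ∧
    IntegrableOn (P.integrand B (P.f a) (fun _ ↦ 1) z₁ z₂ a) (P.U' a) μ

end SubordinateFamily

/-- `B = B_h + B_v` is a pre-Hilbert d-structure on the space of global sections: `B` is a (positive
definite) inner product, `Z` is the direct sum of its h- and v-part, which are `B`-orthogonal, and
`B_h`, `B_v` are the scalar products of the h- and the v-components of the sections. -/
structure IsPreHilbertDStructure (B Bh Bv : q.globalSections → q.globalSections → ℝ) : Prop where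
  preHilbert : ∃ c : InnerProductSpace.Core ℝ q.globalSections, ∀ z₁ z₂, c.inner z₁ z₂ = B z₁ z₂
  isCompl : IsCompl q.hSections q.vSections
  orthogonal : ∀ h ∈ q.hSections, ∀ v ∈ q.vSections, B h v = 0
  split : ∀ z₁ z₂, B z₁ z₂ = Bh z₁ z₂ + Bv z₁ z₂
  h_eq : ∀ h₁ ∈ q.hSections, ∀ h₂ ∈ q.hSections, ∀ v₁ ∈ q.vSections, ∀ v₂ ∈ q.vSections,
    Bh (h₁ + v₁) (h₂ + v₂) = B h₁ h₂
  v_eq : ∀ h₁ ∈ q.hSections, ∀ h₂ ∈ q.hSections, ∀ v₁ ∈ q.vSections, ∀ v₂ ∈ q.vSections,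
    Bv (h₁ + v₁) (h₂ + v₂) = B v₁ v₂

end CechChain

end Gerbe

end NAnholonomic

end

/-! The maps between the fibres of `e_β` and `e_α` over an overlap are composed of restriction
isomorphisms, their inverses and morphisms of the gerbe, all of which are isometries. Hence the
local scalar products of two global sections glue to one continuous function `s` on `V`
(`pointwiseInner`).

Every form in the theorem is then `∫ w s dμ` for a continuous weight `w` (`weightedForm`). By
bilinearity each integrand is `f_a ψ_a s` with `ψ_a = f_a` or `ψ_a = 1`. It vanishes outside `U'_a`,
so the integral may be taken over all of `V`. By compactness only finitely many `f_a` are non-zero,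
and summing gives `w = ∑ f_a ψ_a` (`finsum_setIntegral_integrand`). For a quadratic partition with
`ψ_a = f_a`, and for a partition with `ψ_a = 1`, this weight is `1`, whence the independence of the
choices. For `B_f` it is `∑ f_a²`, which lies between a positive constant and `1`.

A continuous weight `w > 0` always gives a pre-Hilbert d-structure
(`isPreHilbertDStructure_weightedForm`). Two properties of the Riemannian volume enter: it is
finite, so that continuous functions on `V` are integrable, and positive on non-empty open sets, so
that the form is definite. The h- and v-forms reduce to the full form, evaluated on the h- and
v-parts of the sections; these parts are again global sections because the fibre maps commute with
the v-projections. -/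

namespace NAnholonomic

/-! ### Continuity of scalar products in a Riemannian bundle. -/

section Metric

variable {EB : Type*} [NormedAddCommGroup EB] [NormedSpace ℝ EB]
  {HB : Type*} [TopologicalSpace HB] {IB : ModelWithCorners ℝ EB HB} {k : ℕ∞ω}
  {B : Type*} [TopologicalSpace B] [ChartedSpace HB B]
  {F : Type*} [NormedAddCommGroup F] [NormedSpace ℝ F]
  {E : B → Type*} [TopologicalSpace (TotalSpace F E)]
  [∀ b, TopologicalSpace (E b)] [∀ b, AddCommGroup (E b)] [∀ b, Module ℝ (E b)]
  [∀ b, IsTopologicalAddGroup (E b)] [∀ b, ContinuousSMul ℝ (E b)]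
  [FiberBundle F E] [VectorBundle ℝ F E]

/-- The scalar product of two continuous families of vectors is continuous. -/
theorem continuousOn_metric_inner (g : ContMDiffRiemannianMetric IB k F E)
    {X : Type*} [TopologicalSpace X] {b : X → B} {v w : ∀ x, E (b x)} {s : Set X}
    (hv : ContinuousOn (fun x ↦ (⟨b x, v x⟩ : TotalSpace F E)) s)
    (hw : ContinuousOn (fun x ↦ (⟨b x, w x⟩ : TotalSpace F E)) s) :
    ContinuousOn (fun x ↦ g.inner (b x) (v x) (w x)) s :=
  -- The metric `g` is installed as the inner product on the fibres, so that the continuity of inner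
  -- products in Riemannian bundles applies.
  letI : RiemannianBundle E := ⟨g.toRiemannianMetric⟩
  haveI : IsContinuousRiemannianBundle F E :=
    ⟨g.inner, g.contMDiff.continuous, fun _ _ _ ↦ rfl⟩
  ContinuousOn.inner_bundle (F := F) (E := E) hv hw

end Metric

/-! ### The Riemannian volume: finiteness and positivity on open sets. -/

section RiemannianVolume

variable {d : ℕ} {V : Type*} [TopologicalSpace V] [ChartedSpace (EuclideanSpace ℝ (Fin d)) V]
  [IsManifold (𝓡 d) ∞ V]

/-- The coordinate vector fields of a chart are continuous. -/
theorem continuousOn_coordinate_frame (c : V) (e : EuclideanSpace ℝ (Fin d)) :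
    ContinuousOn (fun y : EuclideanSpace ℝ (Fin d) ↦
      (⟨(chartAt (EuclideanSpace ℝ (Fin d)) c).symm y,
        mfderiv (𝓡 d) (𝓡 d) (chartAt (EuclideanSpace ℝ (Fin d)) c).symm y e⟩ :
        TangentBundle (𝓡 d) V)) (chartAt (EuclideanSpace ℝ (Fin d)) c).target := by
  set φ := chartAt (EuclideanSpace ℝ (Fin d)) c
  have h1 : ContMDiffOn (𝓡 d) (𝓡 d) ∞ φ.symm φ.target := contMDiffOn_chart_symm
  -- The coordinate field is the image of the constant field `e` under the tangent map of the
  -- inverse chart.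
  have h2 := h1.continuousOn_tangentMapWithin (by simp) φ.open_target.uniqueMDiffOn
  have h3 : Continuous fun y : EuclideanSpace ℝ (Fin d) ↦
      (⟨y, e⟩ : TangentBundle (𝓡 d) (EuclideanSpace ℝ (Fin d))) :=
    (tangentBundleModelSpaceHomeomorph (𝓡 d)).symm.continuous.comp
      (continuous_id.prodMk continuous_const)
  refine (h2.comp h3.continuousOn (fun y hy ↦ hy)).congr fun y hy ↦ ?_
  simp only [Function.comp, tangentMapWithin, mfderivWithin_of_isOpen φ.open_target hy]

/-- The differential of an inverse chart is injective. -/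
theorem mfderiv_chart_symm_injective (c : V) {y : EuclideanSpace ℝ (Fin d)}
    (hy : y ∈ (chartAt (EuclideanSpace ℝ (Fin d)) c).target) :
    Function.Injective (mfderiv (𝓡 d) (𝓡 d) (chartAt (EuclideanSpace ℝ (Fin d)) c).symm y) := by
  have h := (mdifferentiable_chart (I := 𝓡 d) c).comp_symm_deriv hy
  exact Function.LeftInverse.injective (g := mfderiv (𝓡 d) (𝓡 d)
    (chartAt (EuclideanSpace ℝ (Fin d)) c) ((chartAt (EuclideanSpace ℝ (Fin d)) c).symm y))
    fun v ↦ congrArg (fun L ↦ L v) h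

variable (g : ContMDiffRiemannianMetric (𝓡 d) ∞ (EuclideanSpace ℝ (Fin d))
    (fun u : V ↦ TangentSpace (𝓡 d) u))

theorem continuousOn_volumeDensity (c : V) :
    ContinuousOn (volumeDensity g c) (chartAt (EuclideanSpace ℝ (Fin d)) c).target := by
  refine Real.continuous_sqrt.comp_continuousOn ?_
  simp only [Matrix.det_apply]
  refine continuousOn_finsetSum _ fun σ _ ↦ ContinuousOn.const_smul ?_ _
  refine continuousOn_finsetProd _ fun i _ ↦ ?_
  exact continuousOn_metric_inner g (continuousOn_coordinate_frame c _)
    (continuousOn_coordinate_frame c _)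

/-- The matrix under the root is the Gram matrix of the images of the standard basis under an
injective linear map, hence positive definite. -/
theorem volumeDensity_pos (c : V) {y : EuclideanSpace ℝ (Fin d)}
    (hy : y ∈ (chartAt (EuclideanSpace ℝ (Fin d)) c).target) : 0 < volumeDensity g c y := by
  refine Real.sqrt_pos.2 (Matrix.PosDef.det_pos ?_)
  set φ := chartAt (EuclideanSpace ℝ (Fin d)) c
  set D : EuclideanSpace ℝ (Fin d) →L[ℝ] TangentSpace (𝓡 d) (φ.symm y) :=
    mfderiv (𝓡 d) (𝓡 d) φ.symm y
  refine Matrix.PosDef.of_dotProduct_mulVec_pos ?_ fun a ha ↦ ?_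
  · ext i j
    simp [Matrix.conjTranspose_apply, g.symm]
  · have key : ∀ a : Fin d → ℝ, ∑ i, a i • D (EuclideanSpace.single i 1) =
        D (WithLp.toLp 2 a) := fun a ↦ by
      simp_rw [← map_smul, ← map_sum]
      congr 1
      ext j
      simp [Pi.single_apply]
    have hne : D (WithLp.toLp 2 a) ≠ 0 := by
      rw [← map_zero D]
      intro h
      have := mfderiv_chart_symm_injective c hy h
      exact ha ((WithLp.toLp_eq_zero 2).1 this)
    have := g.pos _ _ hne
    rw [← key] at this
    simp only [map_sum, map_smul, sum_apply, smul_apply,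
      smul_eq_mul] at this
    simp only [dotProduct, Matrix.mulVec, Matrix.of_apply, Finset.mul_sum, star_trivial]
    refine this.trans_eq ?_
    refine Finset.sum_congr rfl fun i _ ↦ ?_
    rw [Finset.mul_sum]
    refine Finset.sum_congr rfl fun j _ ↦ ?_
    rw [g.symm, mul_comm (a j)]
    rfl

/-- `Measure.map` is zero by convention for a map that is not a.e. measurable, so the push-forwards
in `riemannianVolume` can only be evaluated with this. -/
theorem aemeasurable_chart_symm {d : ℕ} {V : Type*} [TopologicalSpace V]
    [ChartedSpace (EuclideanSpace ℝ (Fin d)) V] [MeasurableSpace V] [BorelSpace V] (c : V) :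
    AEMeasurable (chartAt (EuclideanSpace ℝ (Fin d)) c).symm
      ((volume : Measure (EuclideanSpace ℝ (Fin d))).restrict
        (chartAt (EuclideanSpace ℝ (Fin d)) c).target) :=
  (chartAt (EuclideanSpace ℝ (Fin d)) c).continuousOn_symm.aemeasurable
    (chartAt (EuclideanSpace ℝ (Fin d)) c).open_target.measurableSet

variable [T2Space V] [CompactSpace V]

theorem isSubordinate_chartPartition :
    (chartPartition d V).IsSubordinate fun c ↦ (chartAt (EuclideanSpace ℝ (Fin d)) c).source :=
  (SmoothPartitionOfUnity.exists_isSubordinate_chartAt_source (𝓡 d) V).choose_spec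

theorem continuousOn_chartPartition_mul_volumeDensity (c : V) :
    ContinuousOn (fun y ↦ chartPartition d V c
      ((chartAt (EuclideanSpace ℝ (Fin d)) c).symm y) * volumeDensity g c y)
      (chartAt (EuclideanSpace ℝ (Fin d)) c).target :=
  ((chartPartition d V c).contMDiff.continuous.comp_continuousOn
    (chartAt (EuclideanSpace ℝ (Fin d)) c).continuousOn_symm).mul (continuousOn_volumeDensity g c)

/-- The support of the partition function is compact and lies in the chart domain. The integrand is
therefore bounded on its compact image `K` and vanishes on the rest of the target. -/
theorem setLIntegral_chartPartition_mul_volumeDensity_lt_top (c : V) :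
    ∫⁻ y in (chartAt (EuclideanSpace ℝ (Fin d)) c).target,
      ENNReal.ofReal (chartPartition d V c ((chartAt (EuclideanSpace ℝ (Fin d)) c).symm y) *
        volumeDensity g c y) < ⊤ := by
  set φ := chartAt (EuclideanSpace ℝ (Fin d)) c
  have hsub : tsupport (chartPartition d V c) ⊆ φ.source := isSubordinate_chartPartition c
  set K := φ '' tsupport (chartPartition d V c)
  have hK : IsCompact K :=
    (isClosed_tsupport _).isCompact.image_of_continuousOn (φ.continuousOn.mono hsub)
  have hKt : K ⊆ φ.target := by
    rintro _ ⟨x, hx, rfl⟩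
    exact φ.map_source (hsub hx)
  obtain ⟨C, hC⟩ := (hK.image_of_continuousOn
    ((continuousOn_chartPartition_mul_volumeDensity g c).mono hKt)).bddAbove
  calc _ ≤ ∫⁻ y in φ.target, K.indicator (fun _ ↦ ENNReal.ofReal C) y := by
        refine setLIntegral_mono' φ.open_target.measurableSet fun y hy ↦ ?_
        by_cases hyK : y ∈ K
        · rw [indicator_of_mem hyK]
          exact ENNReal.ofReal_le_ofReal (hC ⟨y, hyK, rfl⟩)
        · have : chartPartition d V c (φ.symm y) = 0 := by
            by_contra h
            exact hyK ⟨φ.symm y, subset_tsupport _ h, φ.right_inv hy⟩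
          simp [this]
    _ ≤ ∫⁻ y, K.indicator (fun _ ↦ ENNReal.ofReal C) y := setLIntegral_le_lintegral _ _
    _ = ENNReal.ofReal C * volume K := lintegral_indicator_const hK.measurableSet _
    _ < ⊤ := ENNReal.mul_lt_top ENNReal.ofReal_lt_top hK.measure_lt_top

variable [MeasurableSpace V] [BorelSpace V]

/-- The Riemannian volume of a compact manifold is finite. -/
theorem isFiniteMeasure_riemannianVolume : IsFiniteMeasure (riemannianVolume g) := by
  -- The sum of measures runs over all points of `V`, but local finiteness and compactness leave
  -- only finitely many non-zero terms.
  have hfin : {c : V | (Function.support (chartPartition d V c)).Nonempty}.Finite :=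
    (chartPartition d V).locallyFinite.finite_nonempty_of_compact
  refine ⟨?_⟩
  rw [riemannianVolume, Measure.sum_apply _ MeasurableSet.univ,
    tsum_eq_sum (s := hfin.toFinset) fun c hc ↦ ?_]
  · refine ENNReal.sum_lt_top.2 fun c _ ↦ ?_
    rw [Measure.map_apply_of_aemeasurable ((aemeasurable_chart_symm c).mono_ac
      (withDensity_absolutelyContinuous _ _)) MeasurableSet.univ, preimage_univ,
      withDensity_apply _ MeasurableSet.univ, Measure.restrict_univ]
    exact setLIntegral_chartPartition_mul_volumeDensity_lt_top g c
  · have h0 : ∀ x, chartPartition d V c x = 0 := fun x ↦ by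
      by_contra h
      exact hc (hfin.mem_toFinset.2 ⟨x, h⟩)
    have : (fun y ↦ ENNReal.ofReal (chartPartition d V c
        ((chartAt (EuclideanSpace ℝ (Fin d)) c).symm y) * volumeDensity g c y)) = 0 := by
      ext y
      simp [h0]
    simp only [this, withDensity_zero, Measure.map_zero, Measure.coe_zero, Pi.zero_apply]

/-- The Riemannian volume of a non-empty open set is positive. -/
theorem isOpenPosMeasure_riemannianVolume : (riemannianVolume g).IsOpenPosMeasure := by
  refine ⟨fun W hW ⟨x, hx⟩ hzero ↦ ?_⟩
  obtain ⟨c, hc⟩ : ∃ c, 0 < chartPartition d V c x :=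
    (chartPartition d V).exists_pos_of_mem (mem_univ x)
  set φ := chartAt (EuclideanSpace ℝ (Fin d)) c
  have hxs : x ∈ φ.source := isSubordinate_chartPartition c (subset_tsupport _ hc.ne')
  -- Shrinking `W` to the points where one partition function is positive makes the density of that
  -- single chart term strictly positive on the coordinate image `T`.
  set O := W ∩ {x | 0 < chartPartition d V c x}
  have hO : IsOpen O := hW.inter (isOpen_lt continuous_const (chartPartition d V c).contMDiff.continuous)
  set T := φ.target ∩ φ.symm ⁻¹' O
  have hT : IsOpen T := φ.isOpen_inter_preimage_symm hO
  have hTne : T.Nonempty := ⟨φ x, φ.map_source hxs, by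
    simp only [mem_preimage, φ.left_inv hxs]; exact ⟨hx, hc⟩⟩
  rw [riemannianVolume, Measure.sum_apply _ hW.measurableSet, ENNReal.tsum_eq_zero] at hzero
  have hz := hzero c
  rw [Measure.map_apply_of_aemeasurable ((aemeasurable_chart_symm c).mono_ac
      (withDensity_absolutelyContinuous _ _)) hW.measurableSet] at hz
  replace hz := measure_mono_null (s := T) (fun y hy ↦ hy.2.1) hz
  rw [withDensity_apply _ hT.measurableSet, Measure.restrict_restrict hT.measurableSet,
    inter_eq_left.2 inter_subset_left, lintegral_eq_zero_iff'
      (((continuousOn_chartPartition_mul_volumeDensity g c).mono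
        inter_subset_left).aemeasurable hT.measurableSet).ennreal_ofReal] at hz
  -- The density is a.e. zero on `T` yet positive everywhere on it, so `T` would be a null set; but
  -- it is open and non-empty.
  have hpos : ∀ᵐ y ∂(volume.restrict T), False := by
    filter_upwards [hz, ae_restrict_mem hT.measurableSet] with y hy hyT
    have : 0 < chartPartition d V c (φ.symm y) * volumeDensity g c y :=
      mul_pos hyT.2.2 (volumeDensity_pos g c hyT.1)
    exact this.not_ge (ENNReal.ofReal_eq_zero.1 hy)
  rw [Filter.eventually_false_iff_eq_bot, ae_eq_bot, Measure.restrict_eq_zero] at hpos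
  exact (hT.measure_pos volume hTne).ne' hpos

end RiemannianVolume
end NAnholonomic

noncomputable section

namespace NAnholonomic

universe u v w v₁ u₁

variable {d : ℕ} {V : Type u} [TopologicalSpace V] [ChartedSpace (EuclideanSpace ℝ (Fin d)) V]
  {Q : Type v} [NormedAddCommGroup Q] [NormedSpace ℝ Q]

/-! ### Compatibility of the gluing maps with splitting and metric; h- and v-parts of sections. -/

theorem DVectorBundle.IsoOver.symm_comm_vproj {U' U : Opens V} {h : U' ≤ U}
    {A : DVectorBundle.{u, v, w} (d := d) Q U'} {B : DVectorBundle.{u, v, w} (d := d) Q U}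
    (φ : DVectorBundle.IsoOver h A B) (x : U') (b : B.Fib ⟨x, h x.2⟩) :
    (φ.toEquiv x).symm (B.vproj _ b) = A.vproj x ((φ.toEquiv x).symm b) := by
  rw [ContinuousLinearEquiv.symm_apply_eq, φ.comm_vproj, ContinuousLinearEquiv.apply_symm_apply]

namespace CechChain

variable {𝒞 : VectorGerbe.{u, v, w, v₁, u₁} V d Q} {I : Type*} (q : CechChain 𝒞 I)

/-- Each of the three factors of `fibreMap` respects the splitting. This makes the v-part of a
global section satisfy the gluing condition. -/
theorem fibreMap_vproj (α β : I) (x : V) (hα : x ∈ q.U α) (hβ : x ∈ q.U β)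
    (b : 𝒞.Fib (q.e β) ⟨x, hβ⟩) :
    q.fibreMap α β x hα hβ ((𝒞.bundle (q.e β)).vproj ⟨x, hβ⟩ b) =
      (𝒞.bundle (q.e α)).vproj ⟨x, hα⟩ (q.fibreMap α β x hα hβ b) := by
  let y : ↥(q.U α ⊓ q.U β) := ⟨x, hα, hβ⟩
  change (𝒞.res (homOfLE inf_le_left) (q.e α)).toEquiv y ((𝒞.map (q.q α β)).toEquiv y
    (((𝒞.res (homOfLE inf_le_right) (q.e β)).toEquiv y).symm
      ((𝒞.bundle (q.e β)).vproj ⟨y, hβ⟩ b))) = _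
  rw [DVectorBundle.IsoOver.symm_comm_vproj, (𝒞.map (q.q α β)).comm_vproj]
  exact (𝒞.res (homOfLE inf_le_left) (q.e α)).comm_vproj y _

variable (G : RiemannianDMetric 𝒞)

theorem innerForm_fibreMap (α β : I) (x : V) (hα : x ∈ q.U α) (hβ : x ∈ q.U β)
    (a b : 𝒞.Fib (q.e β) ⟨x, hβ⟩) :
    q.innerForm G α ⟨x, hα⟩ (q.fibreMap α β x hα hβ a) (q.fibreMap α β x hα hβ b) =
      q.innerForm G β ⟨x, hβ⟩ a b := by
  let y : ↥(q.U α ⊓ q.U β) := ⟨x, hα, hβ⟩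
  let r := (𝒞.res (homOfLE inf_le_right) (q.e β)).toEquiv y
  refine (G.res_inner (homOfLE inf_le_left) (q.e α) y _ _).trans ?_
  refine (G.map_inner (q.q α β) y _ _).trans ?_
  refine (G.res_inner (homOfLE inf_le_right) (q.e β) y (r.symm a) (r.symm b)).symm.trans ?_
  change (G.metric (q.e β)).inner ⟨x, hβ⟩ (r (r.symm a)) (r (r.symm b)) = _
  rw [r.apply_symm_apply, r.apply_symm_apply]
  rfl

/-- The v-part of a global section. -/
def vPart : q.globalSections →ₗ[ℝ] q.globalSections where
  toFun z := ⟨fun α ↦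
    ⟨fun x ↦ (𝒞.bundle (q.e α)).vproj x (z.1 α x),
      (𝒞.bundle (q.e α)).vproj_contMDiff.comp (z.1 α).contMDiff⟩, fun α β x hα hβ ↦ by
    change (𝒞.bundle (q.e α)).vproj ⟨x, hα⟩ (z.1 α ⟨x, hα⟩) = q.fibreMap α β x hα hβ
      ((𝒞.bundle (q.e β)).vproj ⟨x, hβ⟩ (z.1 β ⟨x, hβ⟩))
    rw [fibreMap_vproj, z.2 α β x hα hβ]⟩
  map_add' z z' := by
    ext α x
    exact map_add ((𝒞.bundle (q.e α)).vproj x) _ _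
  map_smul' c z := by
    ext α x
    exact map_smul ((𝒞.bundle (q.e α)).vproj x) _ _

/-- The h-part of a global section. -/
def hPart : q.globalSections →ₗ[ℝ] q.globalSections := LinearMap.id - q.vPart

theorem vPart_apply (z : q.globalSections) (α : I) (x : q.U α) :
    (q.vPart z).1 α x = (𝒞.bundle (q.e α)).vproj x (z.1 α x) := rfl

theorem hPart_apply (z : q.globalSections) (α : I) (x : q.U α) :
    (q.hPart z).1 α x = z.1 α x - (𝒞.bundle (q.e α)).vproj x (z.1 α x) := rfl

theorem ext_sections {z z' : q.globalSections} (h : ∀ α x, z.1 α x = z'.1 α x) : z = z' := by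
  ext α x
  exact h α x

theorem vPart_mem (z : q.globalSections) : q.vPart z ∈ q.vSections := fun α x ↦
  (𝒞.bundle (q.e α)).vproj_idem x _

theorem hPart_mem (z : q.globalSections) : q.hPart z ∈ q.hSections := fun α x ↦ by
  rw [hPart_apply, map_sub, (𝒞.bundle (q.e α)).vproj_idem, sub_self]

theorem vPart_add {h v : q.globalSections} (hh : h ∈ q.hSections) (hv : v ∈ q.vSections) :
    q.vPart (h + v) = v := by
  refine q.ext_sections fun α x ↦ ?_
  rw [map_add]
  change (𝒞.bundle (q.e α)).vproj x (h.1 α x) + (𝒞.bundle (q.e α)).vproj x (v.1 α x) = _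
  rw [hh α x, hv α x, zero_add]

theorem hPart_add {h v : q.globalSections} (hh : h ∈ q.hSections) (hv : v ∈ q.vSections) :
    q.hPart (h + v) = h := by
  rw [hPart, LinearMap.sub_apply, LinearMap.id_apply, q.vPart_add hh hv, add_sub_cancel_right]

theorem isCompl_hSections_vSections : IsCompl q.hSections q.vSections := by
  rw [isCompl_iff, Submodule.disjoint_def, codisjoint_iff_le_sup]
  refine ⟨fun z hh hv ↦ q.ext_sections fun α x ↦ (hv α x).symm.trans (hh α x), fun z _ ↦ ?_⟩
  exact Submodule.mem_sup.2 ⟨_, q.hPart_mem z, _, q.vPart_mem z, sub_add_cancel _ _⟩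

/-! ### The pointwise scalar product of global sections -/

/-- The function on `V` glued from the scalar products `⟨₁z_α, ₂z_α⟩`. -/
def pointwiseInner (z₁ z₂ : q.globalSections) (x : V) : ℝ :=
  q.innerForm G (q.covers x).choose ⟨x, (q.covers x).choose_spec⟩
    (z₁.1 (q.covers x).choose ⟨x, (q.covers x).choose_spec⟩)
    (z₂.1 (q.covers x).choose ⟨x, (q.covers x).choose_spec⟩)

/-- The definition picks some index whose open set contains `x`; as the fibre maps are isometries,
any other such index gives the same value. -/
theorem pointwiseInner_eq (z₁ z₂ : q.globalSections) (α : I) (x : q.U α) :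
    q.pointwiseInner G z₁ z₂ x = q.innerForm G α x (z₁.1 α x) (z₂.1 α x) := by
  have hβ := (q.covers (x : V)).choose_spec
  have h₁ := z₁.2 α _ x x.2 hβ
  have h₂ := z₂.2 α _ x x.2 hβ
  change _ = q.innerForm G α ⟨x, x.2⟩ (z₁.1 α ⟨x, x.2⟩) (z₂.1 α ⟨x, x.2⟩)
  rw [h₁, h₂, innerForm_fibreMap]
  rfl

theorem continuous_pointwiseInner (z₁ z₂ : q.globalSections) :
    Continuous (q.pointwiseInner G z₁ z₂) := by
  refine continuous_iff_continuousAt.2 fun x ↦ ?_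
  obtain ⟨α, hα⟩ := q.covers x
  have h := continuousOn_metric_inner (G.metric (q.e α)) (s := univ)
    (z₁.1 α).contMDiff.continuous.continuousOn (z₂.1 α).contMDiff.continuous.continuousOn
  have h' : Continuous fun y : q.U α ↦ q.pointwiseInner G z₁ z₂ y := by
    rw [← continuousOn_univ]
    exact h.congr fun y _ ↦ q.pointwiseInner_eq G z₁ z₂ α y
  -- Continuity at a point may be tested on the open neighbourhood `U α`, where one fixed index
  -- describes the function.
  exact ((q.U α).isOpenEmbedding'.continuousAt_iff (x := ⟨x, hα⟩)).1 h'.continuousAt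

theorem pointwiseInner_add_left (z z' z₂ : q.globalSections) (x : V) :
    q.pointwiseInner G (z + z') z₂ x =
      q.pointwiseInner G z z₂ x + q.pointwiseInner G z' z₂ x := by
  simp [pointwiseInner, innerForm]

theorem pointwiseInner_smul_left (c : ℝ) (z z₂ : q.globalSections) (x : V) :
    q.pointwiseInner G (c • z) z₂ x = c * q.pointwiseInner G z z₂ x := by
  simp [pointwiseInner, innerForm]

theorem pointwiseInner_comm (z₁ z₂ : q.globalSections) (x : V) :
    q.pointwiseInner G z₁ z₂ x = q.pointwiseInner G z₂ z₁ x :=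
  (G.metric _).symm _ _ _

theorem pointwiseInner_self_nonneg (z : q.globalSections) (x : V) :
    0 ≤ q.pointwiseInner G z z x := by
  by_cases h : z.1 (q.covers x).choose ⟨x, (q.covers x).choose_spec⟩ = 0
  · simp [pointwiseInner, innerForm, h]
  · exact ((G.metric _).pos _ _ h).le

theorem eq_zero_of_pointwiseInner_self {z : q.globalSections}
    (h : ∀ x, q.pointwiseInner G z z x = 0) : z = 0 := by
  refine q.ext_sections fun α x ↦ ?_
  by_contra hne
  exact ((G.metric _).pos _ _ hne).ne' ((q.pointwiseInner_eq G z z α x).symm.trans (h x))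

theorem pointwiseInner_h_v {z z' : q.globalSections} (hz : z ∈ q.hSections)
    (hz' : z' ∈ q.vSections) (x : V) : q.pointwiseInner G z z' x = 0 :=
  G.orthogonal _ _ _ _ (hz _ _) (hz' _ _)

theorem pointwiseInner_split (z₁ z₂ : q.globalSections) (x : V) :
    q.pointwiseInner G z₁ z₂ x = q.pointwiseInner G (q.hPart z₁) (q.hPart z₂) x +
      q.pointwiseInner G (q.vPart z₁) (q.vPart z₂) x := by
  have key : ∀ z, z = q.hPart z + q.vPart z := fun z ↦ (sub_add_cancel _ _).symm
  conv_lhs => rw [key z₁, key z₂]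
  rw [pointwiseInner_add_left, pointwiseInner_comm, pointwiseInner_add_left,
    q.pointwiseInner_comm G (q.vPart z₁), pointwiseInner_add_left,
    q.pointwiseInner_h_v G (q.hPart_mem z₂) (q.vPart_mem z₁), pointwiseInner_comm,
    q.pointwiseInner_comm G (q.vPart z₂) (q.hPart z₁),
    q.pointwiseInner_h_v G (q.hPart_mem z₁) (q.vPart_mem z₂), pointwiseInner_comm,
    q.pointwiseInner_comm G (q.vPart z₂)]
  ring

/-! ### Weighted scalar products -/

section Weighted

variable [MeasurableSpace V] (μ : Measure V)

/-- The form `∫ w ⟨₁z, ₂z⟩ dμ` with a weight function `w`. -/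
def weightedForm (w : V → ℝ) (z₁ z₂ : q.globalSections) : ℝ :=
  ∫ x, w x * q.pointwiseInner G z₁ z₂ x ∂μ

variable [CompactSpace V] [BorelSpace V] [IsFiniteMeasure μ]

theorem integrable_weight_mul_pointwiseInner {w : V → ℝ} (hw : Continuous w)
    (z₁ z₂ : q.globalSections) :
    Integrable (fun x ↦ w x * q.pointwiseInner G z₁ z₂ x) μ :=
  (hw.mul (q.continuous_pointwiseInner G z₁ z₂)).integrable_of_hasCompactSupport
    (HasCompactSupport.of_compactSpace _)

/-- A positive continuous weight function defines a pre-Hilbert d-structure. -/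
theorem isPreHilbertDStructure_weightedForm [μ.IsOpenPosMeasure] {w : V → ℝ} (hw : Continuous w)
    (hpos : ∀ x, 0 < w x) :
    q.IsPreHilbertDStructure (q.weightedForm G μ w)
      (fun z₁ z₂ ↦ q.weightedForm G μ w (q.hPart z₁) (q.hPart z₂))
      (fun z₁ z₂ ↦ q.weightedForm G μ w (q.vPart z₁) (q.vPart z₂)) where
  preHilbert := ⟨
    { inner := q.weightedForm G μ w
      conj_inner_symm z z' := integral_congr_ae (.of_forall fun x ↦ by
        simp only [q.pointwiseInner_comm G z z'])
      re_inner_nonneg z := integral_nonneg fun x ↦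
        mul_nonneg (hpos x).le (q.pointwiseInner_self_nonneg G z x)
      add_left z z' z₂ := by
        simp only [weightedForm, pointwiseInner_add_left, mul_add]
        exact integral_add (q.integrable_weight_mul_pointwiseInner G μ hw z z₂)
          (q.integrable_weight_mul_pointwiseInner G μ hw z' z₂)
      smul_left z z₂ c := by
        simp only [weightedForm, pointwiseInner_smul_left, mul_left_comm _ c]
        exact integral_const_mul c _
      definite z hz := by
        have h0 := (integral_eq_zero_iff_of_nonneg
          (fun x ↦ mul_nonneg (hpos x).le (q.pointwiseInner_self_nonneg G z x))
          (q.integrable_weight_mul_pointwiseInner G μ hw z z)).1 hz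
        -- Continuous functions that agree a.e. agree everywhere when non-empty open sets have
        -- positive measure.
        have h1 := (hw.mul (q.continuous_pointwiseInner G z z)).ae_eq_iff_eq μ
          continuous_zero |>.1 h0
        exact q.eq_zero_of_pointwiseInner_self G fun x ↦
          (mul_eq_zero.1 (congrFun h1 x)).resolve_left (hpos x).ne' }, fun _ _ ↦ rfl⟩
  isCompl := q.isCompl_hSections_vSections
  orthogonal h hh v hv := by simp [weightedForm, q.pointwiseInner_h_v G hh hv]
  split z₁ z₂ := by
    simp only [weightedForm, q.pointwiseInner_split G z₁ z₂, mul_add]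
    exact integral_add (q.integrable_weight_mul_pointwiseInner G μ hw _ _)
      (q.integrable_weight_mul_pointwiseInner G μ hw _ _)
  h_eq h₁ hh₁ h₂ hh₂ v₁ hv₁ v₂ hv₂ := by
    rw [q.hPart_add hh₁ hv₁, q.hPart_add hh₂ hv₂]
  v_eq h₁ hh₁ h₂ hh₂ v₁ hv₁ v₂ hv₂ := by
    rw [q.vPart_add hh₁ hv₁, q.vPart_add hh₂ hv₂]

end Weighted

/-! ### Reduction of the sums over a subordinate family to weighted integrals. -/

namespace SubordinateFamily

variable {q} {I' : Type*} (P : q.SubordinateFamily I')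

theorem integrand_innerForm (φ ψ : V → ℝ) (z₁ z₂ : q.globalSections) {a : I'} {x : V}
    (hx : x ∈ q.U (P.idx a)) :
    P.integrand (q.innerForm G) φ ψ z₁ z₂ a x = φ x * ψ x * q.pointwiseInner G z₁ z₂ x := by
  rw [integrand, dif_pos hx, q.pointwiseInner_eq G z₁ z₂ (P.idx a) ⟨x, hx⟩]
  simp [innerForm, mul_assoc, mul_left_comm]

/-- Since the v-projection is linear, weighting and projecting commute. With the analogue for the
h-form, everything about integrals needs proof only for `innerForm`. -/
theorem integrand_vForm (φ ψ : V → ℝ) (z₁ z₂ : q.globalSections) :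
    P.integrand (q.vForm G) φ ψ z₁ z₂ =
      P.integrand (q.innerForm G) φ ψ (q.vPart z₁) (q.vPart z₂) := by
  ext a x
  simp only [integrand, vForm, innerForm, vPart_apply, map_smul]

theorem integrand_hForm (φ ψ : V → ℝ) (z₁ z₂ : q.globalSections) :
    P.integrand (q.hForm G) φ ψ z₁ z₂ =
      P.integrand (q.innerForm G) φ ψ (q.hPart z₁) (q.hPart z₂) := by
  ext a x
  simp only [integrand, hForm, innerForm, hPart_apply, map_smul, smul_sub]

theorem f_eq_zero_of_notMem {a : I'} {x : V} (hx : x ∉ P.U' a) : P.f a x = 0 :=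
  image_eq_zero_of_notMem_tsupport fun h ↦ hx (P.tsupport_subset a h)

theorem integrand_innerForm_eqOn (ψ : V → ℝ) (z₁ z₂ : q.globalSections) (a : I') :
    EqOn (fun x ↦ P.f a x * ψ x * q.pointwiseInner G z₁ z₂ x)
      (P.integrand (q.innerForm G) (P.f a) ψ z₁ z₂ a) (P.U' a) := fun _ hx ↦
  (P.integrand_innerForm G (P.f a) ψ z₁ z₂ (P.le a hx)).symm

section Integrals

variable [CompactSpace V]

theorem finite_ne_zero : {a | P.f a ≠ 0}.Finite :=
  P.locallyFinite.finite_nonempty_of_compact.subset fun _ ha ↦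
    Function.support_nonempty_iff.2 ha

/-- The sum of the weights `f_a ψ_a`. -/
def totalWeight (ψ : I' → V → ℝ) (x : V) : ℝ :=
  ∑ a ∈ P.finite_ne_zero.toFinset, P.f a x * ψ a x

theorem totalWeight_eq_finsum (ψ : I' → V → ℝ) (x : V) :
    P.totalWeight ψ x = ∑ᶠ a, P.f a x * ψ a x := by
  -- `finsum` defaults to `0` on infinite support; here an index with `f_a = 0` contributes nothing,
  -- so the support is finite.
  refine (finsum_eq_sum_of_support_subset _ fun a ha ↦ ?_).symm
  rw [Finite.coe_toFinset]
  rintro h0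
  exact ha (by simp [h0])

theorem continuous_totalWeight {ψ : I' → V → ℝ} (hψ : ∀ a, Continuous (ψ a)) :
    Continuous (P.totalWeight ψ) :=
  continuous_finsetSum _ fun a _ ↦ (P.contMDiff a).continuous.mul (hψ a)

variable [MeasurableSpace V] [BorelSpace V] (μ : Measure V) [IsFiniteMeasure μ]

theorem integrableOn_integrand_innerForm {ψ : V → ℝ} (hψ : Continuous ψ)
    (z₁ z₂ : q.globalSections) (a : I') :
    IntegrableOn (P.integrand (q.innerForm G) (P.f a) ψ z₁ z₂ a) (P.U' a) μ :=
  IntegrableOn.congr_fun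
    (q.integrable_weight_mul_pointwiseInner G μ
      ((P.contMDiff a).continuous.mul hψ) z₁ z₂).integrableOn
    (P.integrand_innerForm_eqOn G ψ z₁ z₂ a) (P.U' a).isOpen.measurableSet

/-- The one computation behind both pairings: `ψ = f` gives `pairing`, and `ψ = 1` gives
`linearPairing`. -/
theorem finsum_setIntegral_integrand {ψ : I' → V → ℝ} (hψ : ∀ a, Continuous (ψ a))
    (z₁ z₂ : q.globalSections) :
    ∑ᶠ a, ∫ x in (P.U' a : Set V), P.integrand (q.innerForm G) (P.f a) (ψ a) z₁ z₂ a x ∂μ =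
      q.weightedForm G μ (P.totalWeight ψ) z₁ z₂ := by
  have key : ∀ a, ∫ x in (P.U' a : Set V),
      P.integrand (q.innerForm G) (P.f a) (ψ a) z₁ z₂ a x ∂μ =
      ∫ x, P.f a x * ψ a x * q.pointwiseInner G z₁ z₂ x ∂μ := fun a ↦ by
    rw [← setIntegral_congr_fun (P.U' a).isOpen.measurableSet
      (P.integrand_innerForm_eqOn G (ψ a) z₁ z₂ a)]
    exact setIntegral_eq_integral_of_forall_compl_eq_zero fun x hx ↦ by
      rw [P.f_eq_zero_of_notMem hx, zero_mul, zero_mul]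
  simp only [key, weightedForm, totalWeight, Finset.sum_mul]
  rw [integral_finsetSum (f := fun a x ↦ P.f a x * ψ a x * q.pointwiseInner G z₁ z₂ x) _
    fun a _ ↦ q.integrable_weight_mul_pointwiseInner G μ
    ((P.contMDiff a).continuous.mul (hψ a)) z₁ z₂]
  refine finsum_eq_sum_of_support_subset _ fun a ha ↦ ?_
  rw [Finite.coe_toFinset]
  rintro h0
  exact ha (by simp [h0])

theorem pairing_innerForm :
    P.pairing μ (q.innerForm G) = q.weightedForm G μ (P.totalWeight P.f) := by
  ext z₁ z₂
  exact P.finsum_setIntegral_integrand G μ (fun a ↦ (P.contMDiff a).continuous) z₁ z₂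

theorem linearPairing_innerForm :
    P.linearPairing μ (q.innerForm G) = q.weightedForm G μ (P.totalWeight fun _ _ ↦ 1) := by
  ext z₁ z₂
  exact P.finsum_setIntegral_integrand G μ (fun _ ↦ continuous_const) z₁ z₂

theorem pairing_hForm : P.pairing μ (q.hForm G) = fun z₁ z₂ ↦
    q.weightedForm G μ (P.totalWeight P.f) (q.hPart z₁) (q.hPart z₂) := by
  ext z₁ z₂
  rw [← pairing_innerForm]
  simp only [pairing, integrand_hForm]

theorem pairing_vForm : P.pairing μ (q.vForm G) = fun z₁ z₂ ↦
    q.weightedForm G μ (P.totalWeight P.f) (q.vPart z₁) (q.vPart z₂) := by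
  ext z₁ z₂
  rw [← pairing_innerForm]
  simp only [pairing, integrand_vForm]

theorem linearPairing_hForm : P.linearPairing μ (q.hForm G) = fun z₁ z₂ ↦
    q.weightedForm G μ (P.totalWeight fun _ _ ↦ 1) (q.hPart z₁) (q.hPart z₂) := by
  ext z₁ z₂
  rw [← linearPairing_innerForm]
  simp only [linearPairing, integrand_hForm]

theorem linearPairing_vForm : P.linearPairing μ (q.vForm G) = fun z₁ z₂ ↦
    q.weightedForm G μ (P.totalWeight fun _ _ ↦ 1) (q.vPart z₁) (q.vPart z₂) := by
  ext z₁ z₂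
  rw [← linearPairing_innerForm]
  simp only [linearPairing, integrand_vForm]

theorem converges_innerForm : P.Converges μ (q.innerForm G) :=
  ⟨P.finite_ne_zero, fun z₁ z₂ a ↦
    ⟨P.integrableOn_integrand_innerForm G μ (P.contMDiff a).continuous z₁ z₂ a,
      P.integrableOn_integrand_innerForm G μ continuous_const z₁ z₂ a⟩⟩

theorem converges_hForm : P.Converges μ (q.hForm G) :=
  ⟨P.finite_ne_zero, fun z₁ z₂ a ↦ by
    simp only [integrand_hForm]
    exact (P.converges_innerForm G μ).2 _ _ a⟩

theorem converges_vForm : P.Converges μ (q.vForm G) :=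
  ⟨P.finite_ne_zero, fun z₁ z₂ a ↦ by
    simp only [integrand_vForm]
    exact (P.converges_innerForm G μ).2 _ _ a⟩

end Integrals

/-! ### Values and bounds of the total weight for the two kinds of partition. -/

section Bounds

variable [CompactSpace V] {P}

theorem IsQuadraticPartition.totalWeight (hP : P.IsQuadraticPartition) :
    P.totalWeight P.f = fun _ ↦ 1 := by
  ext x
  simp only [totalWeight_eq_finsum, ← pow_two]
  exact hP x

theorem IsPartition.totalWeight (hP : P.IsPartition) :
    (P.totalWeight fun _ _ ↦ 1) = fun _ ↦ 1 := by
  ext x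
  simp only [totalWeight_eq_finsum, mul_one]
  exact hP x

theorem IsPartition.totalWeight_self_le_one (hP : P.IsPartition) (x : V) :
    P.totalWeight P.f x ≤ 1 := by
  have h1 := congrFun hP.totalWeight x
  simp only [SubordinateFamily.totalWeight, mul_one] at h1 ⊢
  rw [← h1]
  -- Each `f_a` is one term of a non-negative sum equal to `1`, so `f_a ≤ 1` and `f_a² ≤ f_a`.
  refine Finset.sum_le_sum fun a ha ↦ mul_le_of_le_one_left (P.nonneg a x) ?_
  rw [← h1]
  exact Finset.single_le_sum (fun b _ ↦ P.nonneg b x) ha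

theorem IsPartition.exists_le_totalWeight_self (hP : P.IsPartition) :
    ∃ c : ℝ, 0 < c ∧ ∀ x, c ≤ P.totalWeight P.f x := by
  -- Cauchy–Schwarz gives `1 = (∑ f_a)² ≤ k ∑ f_a²` for `k` non-zero functions. The `+ 1` keeps the
  -- constant positive when `k = 0`, which can occur for empty `V`.
  refine ⟨((P.finite_ne_zero.toFinset.card : ℝ) + 1)⁻¹, by positivity, fun x ↦ ?_⟩
  have h1 := congrFun hP.totalWeight x
  simp only [SubordinateFamily.totalWeight, mul_one] at h1 ⊢
  have h2 := sq_sum_le_card_mul_sum_sq (s := P.finite_ne_zero.toFinset) (f := fun a ↦ P.f a x)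
  rw [h1] at h2
  simp only [← pow_two]
  rw [inv_le_iff_one_le_mul₀' (by positivity)]
  have h3 : 0 ≤ ∑ a ∈ P.finite_ne_zero.toFinset, P.f a x ^ 2 :=
    Finset.sum_nonneg fun a _ ↦ sq_nonneg _
  linarith

end Bounds

end SubordinateFamily

end CechChain

end NAnholonomic

end

open NAnholonomic Manifold ContDiff in
theorem mainTheorem7 {n m : ℕ}
    {M : Type*} [TopologicalSpace M] [ChartedSpace (EuclideanSpace ℝ (Fin n)) M]
    [IsManifold (𝓡 n) ∞ M] [T2Space M]
    {V : Type*} [TopologicalSpace V] [ChartedSpace (EuclideanSpace ℝ (Fin (n + m))) V]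
    [IsManifold (𝓡 (n + m)) ∞ V] [T2Space V] [CompactSpace V] [MeasurableSpace V] [BorelSpace V]
    (p : V → M) (hp : Function.Surjective p) (hp' : IsSubmersion (𝓡 (n + m)) (𝓡 n) ∞ p)
    (N : NConnection (n := n) (m := m) p) (g : DMetric N)
    {Q : Type*} [NormedAddCommGroup Q] [NormedSpace ℝ Q] [FiniteDimensional ℝ Q]
    (𝒞 : VectorGerbe V (n + m) Q) (G : RiemannianDMetric 𝒞)
    {I : Type*} (q : CechChain 𝒞 I)
    (μ : MeasureTheory.Measure V) (hμ : μ = riemannianVolume g.metric) :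
    ∃ B Bh Bv : q.globalSections → q.globalSections → ℝ,
      q.IsPreHilbertDStructure B Bh Bv ∧
      (∀ z₁ z₂ : q.globalSections, ∃ s : V → ℝ, Continuous s ∧
        (∀ (α : I) (x : q.U α), s x = q.innerForm G α x (z₁.1 α x) (z₂.1 α x)) ∧
        B z₁ z₂ = ∫ x, s x ∂μ) ∧
      (∀ {I' : Type*} (P : q.SubordinateFamily I'), P.IsQuadraticPartition →
        (P.Converges μ (q.innerForm G) ∧ P.Converges μ (q.hForm G) ∧ P.Converges μ (q.vForm G)) ∧
        P.pairing μ (q.innerForm G) = B ∧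
        P.pairing μ (q.hForm G) = Bh ∧
        P.pairing μ (q.vForm G) = Bv) ∧
      (∀ {I' : Type*} (P : q.SubordinateFamily I'), P.IsPartition →
        (P.Converges μ (q.innerForm G) ∧ P.Converges μ (q.hForm G) ∧ P.Converges μ (q.vForm G)) ∧
        (P.linearPairing μ (q.innerForm G) = B ∧
          P.linearPairing μ (q.hForm G) = Bh ∧
          P.linearPairing μ (q.vForm G) = Bv) ∧
        q.IsPreHilbertDStructure (P.pairing μ (q.innerForm G)) (P.pairing μ (q.hForm G))
          (P.pairing μ (q.vForm G)) ∧
        ∃ c : ℝ, 0 < c ∧ ∀ z : q.globalSections,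
          c * B z z ≤ P.pairing μ (q.innerForm G) z z ∧
          P.pairing μ (q.innerForm G) z z ≤ B z z) := by
  subst hμ
  set μ := riemannianVolume g.metric
  have : MeasureTheory.IsFiniteMeasure μ := isFiniteMeasure_riemannianVolume g.metric
  have : μ.IsOpenPosMeasure := isOpenPosMeasure_riemannianVolume g.metric
  refine ⟨q.weightedForm G μ fun _ ↦ 1,
    fun z₁ z₂ ↦ q.weightedForm G μ (fun _ ↦ 1) (q.hPart z₁) (q.hPart z₂),
    fun z₁ z₂ ↦ q.weightedForm G μ (fun _ ↦ 1) (q.vPart z₁) (q.vPart z₂),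
    q.isPreHilbertDStructure_weightedForm G μ continuous_const fun _ ↦ one_pos,
    fun z₁ z₂ ↦ ⟨q.pointwiseInner G z₁ z₂, q.continuous_pointwiseInner G z₁ z₂,
      q.pointwiseInner_eq G z₁ z₂, by simp only [CechChain.weightedForm, one_mul]⟩,
    fun P hP ↦ ⟨⟨P.converges_innerForm G μ, P.converges_hForm G μ, P.converges_vForm G μ⟩, ?_⟩,
    fun P hP ↦ ⟨⟨P.converges_innerForm G μ, P.converges_hForm G μ, P.converges_vForm G μ⟩,
      ?_, ?_, ?_⟩⟩
  · rw [P.pairing_innerForm, P.pairing_hForm, P.pairing_vForm, hP.totalWeight]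
    exact ⟨rfl, rfl, rfl⟩
  · rw [P.linearPairing_innerForm, P.linearPairing_hForm, P.linearPairing_vForm, hP.totalWeight]
    exact ⟨rfl, rfl, rfl⟩
  · rw [P.pairing_innerForm, P.pairing_hForm, P.pairing_vForm]
    obtain ⟨c, hc, hle⟩ := hP.exists_le_totalWeight_self
    exact q.isPreHilbertDStructure_weightedForm G μ
      (P.continuous_totalWeight fun a ↦ (P.contMDiff a).continuous) fun x ↦ hc.trans_le (hle x)
  · obtain ⟨c, hc, hle⟩ := hP.exists_le_totalWeight_self
    have hw := P.continuous_totalWeight fun a ↦ (P.contMDiff a).continuous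
    refine ⟨c, hc, fun z ↦ ?_⟩
    rw [P.pairing_innerForm, CechChain.weightedForm, CechChain.weightedForm,
      ← MeasureTheory.integral_const_mul]
    -- Both inequalities are the pointwise bounds `c ≤ ∑ f_a² ≤ 1`, multiplied by the non-negative
    -- function `⟨z, z⟩` and integrated.
    exact ⟨MeasureTheory.integral_mono
        ((q.integrable_weight_mul_pointwiseInner G μ continuous_const z z).const_mul c)
        (q.integrable_weight_mul_pointwiseInner G μ hw z z) fun x ↦ by
          simpa using mul_le_mul_of_nonneg_right (hle x) (q.pointwiseInner_self_nonneg G z x),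
      MeasureTheory.integral_mono (q.integrable_weight_mul_pointwiseInner G μ hw z z)
        (q.integrable_weight_mul_pointwiseInner G μ continuous_const z z) fun x ↦
          mul_le_mul_of_nonneg_right (hP.totalWeight_self_le_one x)
            (q.pointwiseInner_self_nonneg G z x)⟩
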